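/- **Theorem (singular locus of Lauricella's system for $F_B$).** Let $m$ be a non-negative integer and let $D=\mathbb{C}[x_1,\dots,x_m]\langle\partial_1,\dots,\partial_m\rangle$ be the ring of differential operators with polynomial coefficients; put $\theta_i=x_i\partial_i$. Let $a_1,\dots,a_m,b_1,\dots,b_m,c\in\mathbb{C}$ be arbitrary complex numbers (no condition is imposed on them), let $$\ell_i^B=\theta_i(\theta_1+\cdots+\theta_m+c-1)-x_i(\theta_i+a_i)(\theta_i+b_i)\qquad(i=1,\dots,m),$$ and let $I_B(m)$ be the left ideal of $D$ generated by $\ell_1^B,\dots,\ell_m^B$. For $P=\sum_{\alpha,\beta}c_{\alpha,\beta}x^\alpha\partial^\beta\in D$, let $\mathrm{in}_{(\mathbf 0,\mathbf 1)}(P)\in\mathbb{C}[x,\xi]=\mathbb{C}[x_1,\dots,x_m,\xi_1,\dots,\xi_m]$ be the sum of the terms $c_{\alpha,\beta}x^\alpha\xi^\beta$ for which $|\beta|$ is maximal among those with $c_{\alpha,\beta}\neq0$ (and $\mathrm{in}_{(\mathbf 0,\mathbf 1)}(0)=0$). For a left ideal $I$ of $D$, let $\mathrm{in}_{(\mathbf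 0,\mathbf 1)}(I)$ be the ideal of $\mathbb{C}[x,\xi]$ generated by all $\mathrm{in}_{(\mathbf 0,\mathbf 1)}(P)$ with $P\in I$, let $\mathrm{Ch}(I)\subseteq\mathbb{C}^{2m}$ be its zero set (the characteristic variety of $I$), and let $$\mathrm{Sing}(I)=\pi\bigl(\mathrm{Ch}(I)\setminus\{\xi_1=\cdots=\xi_m=0\}\bigr),\qquad \pi(x,\xi)=x .$$ Then $\mathrm{Sing}(I_B(m))\subseteq\mathbb{C}^m$ is exactly the zero set of the polynomial $$x_1\cdots x_m\;\prod_{i=1}^m(1-x_i)\;\prod_{\substack{S\subseteq\{1,\dots,m\}\\ |S|\ge 2}}\Bigl(\prod_{i\in S}x_i-\sum_{k\in S}\ \prod_{l\in S,\ l\neq k}x_l\Bigr),$$ that is, of $x_1\cdots x_m\prod_i(1-x_i)\prod_{i<j}(x_ix_j-x_i-x_j)\cdots\bigl(x_1\cdots x_m-\sum_k\prod_{l\neq k}x_l\bigr)$. -/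

import Mathlib

open MvPolynomial

noncomputable section

namespace Lauricella

/-- The ring `D = ℂ[x₁, …, xₘ]⟨∂₁, …, ∂ₘ⟩` of differential operators with polynomial
coefficients: the `ℂ`-algebra of operators on `ℂ[x₁, …, xₘ]` generated by the multiplications
by `xᵢ` and the partial derivatives `∂ᵢ`. -/
def weyl (m : ℕ) : Subalgebra ℂ (Module.End ℂ (MvPolynomial (Fin m) ℂ)) :=
  Algebra.adjoin ℂ
    (Set.range (fun i => LinearMap.mulLeft ℂ (X i : MvPolynomial (Fin m) ℂ)) ∪
      Set.range (fun i => ((pderiv i : Derivation ℂ (MvPolynomial (Fin m) ℂ) _) :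
        MvPolynomial (Fin m) ℂ →ₗ[ℂ] MvPolynomial (Fin m) ℂ)))

/-- `xᵢ` as an element of `D`. -/
def x {m : ℕ} (i : Fin m) : weyl m :=
  ⟨LinearMap.mulLeft ℂ (X i), Algebra.subset_adjoin (Or.inl ⟨i, rfl⟩)⟩

/-- `∂ᵢ` as an element of `D`. -/
def d {m : ℕ} (i : Fin m) : weyl m :=
  ⟨(pderiv i : Derivation ℂ (MvPolynomial (Fin m) ℂ) _), Algebra.subset_adjoin (Or.inr ⟨i, rfl⟩)⟩

/-- The Euler operator `θᵢ = xᵢ ∂ᵢ`. -/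
def theta {m : ℕ} (i : Fin m) : weyl m := x i * d i

/-- `ℓᵢᴮ = θᵢ (θ₁ + ⋯ + θₘ + c - 1) - xᵢ (θᵢ + aᵢ) (θᵢ + bᵢ)`. -/
def ellB {m : ℕ} (a b : Fin m → ℂ) (c : ℂ) (i : Fin m) : weyl m :=
  theta i * ((∑ j, theta j) + algebraMap ℂ (weyl m) (c - 1)) -
    x i * (theta i + algebraMap ℂ (weyl m) (a i)) * (theta i + algebraMap ℂ (weyl m) (b i))

/-- Lauricella's system `I_B(m)`: the left ideal of `D` generated by `ℓ₁ᴮ, …, ℓₘᴮ`. -/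
def idealB {m : ℕ} (a b : Fin m → ℂ) (c : ℂ) : Ideal (weyl m) :=
  Ideal.span (Set.range (ellB a b c))

/-! ### Normally ordered expansion of a differential operator

The commutative ring `ℂ[x, ξ]` is `MvPolynomial (Fin m ⊕ Fin m) ℂ`: the variable `Sum.inl i` is
`xᵢ` and the variable `Sum.inr i` is `ξᵢ`. -/

/-- `x₁^{α₁} ⋯ xₘ^{αₘ}` in `D`. -/
def xPow {m : ℕ} (α : Fin m → ℕ) : weyl m := ((List.finRange m).map fun i => x i ^ α i).prod

/-- `∂₁^{β₁} ⋯ ∂ₘ^{βₘ}` in `D`. -/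
def dPow {m : ℕ} (β : Fin m → ℕ) : weyl m := ((List.finRange m).map fun i => d i ^ β i).prod

/-- The linear map `∑ c_{αβ} x^α ξ^β ↦ ∑ c_{αβ} x^α ∂^β`. -/
def normalOrder (m : ℕ) : MvPolynomial (Fin m ⊕ Fin m) ℂ →ₗ[ℂ] weyl m :=
  (basisMonomials (Fin m ⊕ Fin m) ℂ).constr ℂ
    (fun s => xPow (fun i => s (Sum.inl i)) * dPow (fun i => s (Sum.inr i)))

theorem x_apply {m : ℕ} (i : Fin m) (f : MvPolynomial (Fin m) ℂ) :
    (x i : Module.End ℂ (MvPolynomial (Fin m) ℂ)) f = X i * f := rfl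

theorem d_apply {m : ℕ} (i : Fin m) (f : MvPolynomial (Fin m) ℂ) :
    (d i : Module.End ℂ (MvPolynomial (Fin m) ℂ)) f = pderiv i f := rfl

theorem normalOrder_monomial {m : ℕ} (s : Fin m ⊕ Fin m →₀ ℕ) (z : ℂ) :
    normalOrder m (monomial s z) =
      z • (xPow (fun i => s (Sum.inl i)) * dPow (fun i => s (Sum.inr i))) := by
  have h : monomial s z = z • basisMonomials (Fin m ⊕ Fin m) ℂ s := by
    simp [smul_monomial]
  rw [h, map_smul, normalOrder, Module.Basis.constr_basis]

theorem xPow_apply {m : ℕ} (α : Fin m → ℕ) (f : MvPolynomial (Fin m) ℂ) :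
    (xPow α : Module.End ℂ (MvPolynomial (Fin m) ℂ)) f = (∏ i, X i ^ α i) * f := by
  have key : ∀ L : List (Fin m),
      (((L.map fun i => x i ^ α i).prod : weyl m) : Module.End ℂ (MvPolynomial (Fin m) ℂ)) f =
        (L.map fun i => (X i : MvPolynomial (Fin m) ℂ) ^ α i).prod * f := by
    intro L
    induction L with
    | nil => simp
    | cons i L ih =>
      have hp : ∀ (n : ℕ) (g : MvPolynomial (Fin m) ℂ),
          ((x i : Module.End ℂ (MvPolynomial (Fin m) ℂ)) ^ n) g = X i ^ n * g := by
        intro n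
        induction n with
        | zero => simp
        | succ n ihn => intro g; rw [pow_succ', Module.End.mul_apply, ihn, x_apply]; ring
      rw [List.map_cons, List.prod_cons, List.map_cons, List.prod_cons, Subalgebra.coe_mul,
        Module.End.mul_apply, ih, Subalgebra.coe_pow, hp, mul_assoc]
  rw [xPow, key, ← List.ofFn_eq_map, List.prod_ofFn]

theorem coeff_pderiv' {m : ℕ} (i : Fin m) (f : MvPolynomial (Fin m) ℂ) (δ : Fin m →₀ ℕ) :
    coeff δ (pderiv i f) = coeff (δ + Finsupp.single i 1) f * (δ i + 1) := by
  induction f using MvPolynomial.induction_on' with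
  | add p q hp hq => rw [map_add, coeff_add, hp, hq, coeff_add]; ring
  | monomial s z =>
    rw [pderiv_monomial, coeff_monomial, coeff_monomial]
    by_cases h : s = δ + Finsupp.single i 1
    · subst h; simp
    · rw [if_neg h, zero_mul]
      split_ifs with h2
      · by_cases h3 : s i = 0
        · simp [h3]
        · refine absurd ?_ h
          rw [← h2, tsub_add_cancel_of_le]
          simpa using Nat.one_le_iff_ne_zero.mpr h3
      · rfl

theorem coeff_dPow {m : ℕ} (β : Fin m →₀ ℕ) (f : MvPolynomial (Fin m) ℂ) (δ : Fin m →₀ ℕ) :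
    coeff δ ((dPow β : Module.End ℂ (MvPolynomial (Fin m) ℂ)) f) =
      coeff (δ + β) f * ∏ i, (((δ i + 1).ascFactorial (β i) : ℕ) : ℂ) := by
  have hp : ∀ (i : Fin m) (n : ℕ) (g : MvPolynomial (Fin m) ℂ) (δ : Fin m →₀ ℕ),
      coeff δ (((d i : Module.End ℂ (MvPolynomial (Fin m) ℂ)) ^ n) g) =
        coeff (δ + Finsupp.single i n) g * (((δ i + 1).ascFactorial n : ℕ) : ℂ) := by
    intro i n
    induction n with
    | zero => simp
    | succ n ihn =>
      intro g δ
      rw [pow_succ, Module.End.mul_apply, ihn, d_apply, coeff_pderiv', add_assoc,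
        ← Finsupp.single_add, Nat.ascFactorial_succ]
      simp only [Finsupp.add_apply, Finsupp.single_eq_same]
      push_cast
      ring
  have key : ∀ L : List (Fin m), L.Nodup → ∀ δ : Fin m →₀ ℕ,
      coeff δ ((((L.map fun i => d i ^ β i).prod : weyl m) :
          Module.End ℂ (MvPolynomial (Fin m) ℂ)) f) =
        coeff (δ + (L.map fun i => Finsupp.single i (β i)).sum) f *
          (L.map fun i => (((δ i + 1).ascFactorial (β i) : ℕ) : ℂ)).prod := by
    intro L
    induction L with
    | nil => simp
    | cons i L ih =>
      intro hL δ
      rw [List.nodup_cons] at hL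
      rw [List.map_cons, List.prod_cons, List.map_cons, List.sum_cons, List.map_cons,
        List.prod_cons, Subalgebra.coe_mul, Module.End.mul_apply, Subalgebra.coe_pow, hp,
        ih hL.2, add_assoc]
      have : (L.map fun j => ((((δ + Finsupp.single i (β i)) j + 1).ascFactorial (β j) : ℕ) : ℂ)) =
          L.map fun j => (((δ j + 1).ascFactorial (β j) : ℕ) : ℂ) := by
        apply List.map_congr_left
        intro j hj
        have hij : i ≠ j := fun h => hL.1 (h ▸ hj)
        simp [hij]
      rw [this]
      ring
  have hs : ((List.finRange m).map fun i => Finsupp.single i (β i)).sum = β := by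
    rw [← List.ofFn_eq_map, List.sum_ofFn]
    exact Finsupp.univ_sum_single β
  rw [dPow, key _ (List.nodup_finRange m), hs, ← List.ofFn_eq_map, List.prod_ofFn]

theorem x_mul_xPow {m : ℕ} (i : Fin m) (α : Fin m →₀ ℕ) :
    x i * xPow α = xPow (α + Finsupp.single i 1 : Fin m →₀ ℕ) := by
  apply Subtype.ext
  apply LinearMap.ext
  intro f
  rw [Subalgebra.coe_mul, Module.End.mul_apply, x_apply, xPow_apply, xPow_apply, ← mul_assoc]
  congr 1
  simp only [Finsupp.add_apply, pow_add, Finset.prod_mul_distrib]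
  rw [mul_comm]
  congr 1
  rw [Finset.prod_eq_single i] <;> simp +contextual [eq_comm]

theorem d_mul_dPow {m : ℕ} (i : Fin m) (β : Fin m →₀ ℕ) :
    d i * dPow β = dPow (β + Finsupp.single i 1 : Fin m →₀ ℕ) := by
  apply Subtype.ext
  apply LinearMap.ext
  intro f
  ext δ
  rw [Subalgebra.coe_mul, Module.End.mul_apply, d_apply, coeff_pderiv', coeff_dPow, coeff_dPow,
    add_assoc, add_comm (Finsupp.single i 1) β, mul_assoc]
  congr 1
  rw [← Finset.mul_prod_erase _ _ (Finset.mem_univ i),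
    ← Finset.mul_prod_erase (Finset.univ) (fun j : Fin m =>
      (((δ j + 1).ascFactorial ((β + Finsupp.single i 1 : Fin m →₀ ℕ) j) : ℕ) : ℂ))
      (Finset.mem_univ i)]
  have h1 : ∏ j ∈ Finset.univ.erase i,
      ((((δ + Finsupp.single i 1 : Fin m →₀ ℕ) j + 1).ascFactorial (β j) : ℕ) : ℂ) =
      ∏ j ∈ Finset.univ.erase i,
        (((δ j + 1).ascFactorial ((β + Finsupp.single i 1 : Fin m →₀ ℕ) j) : ℕ) : ℂ) := by
    apply Finset.prod_congr rfl
    intro j hj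
    have hij : i ≠ j := fun h => (Finset.ne_of_mem_erase hj) h.symm
    simp [hij]
  have h2 : (δ i + 1).ascFactorial (β i + 1) = (δ i + 1) * (δ i + 1 + 1).ascFactorial (β i) := by
    have := Nat.succ_ascFactorial (δ i + 1) (β i)
    rw [Nat.ascFactorial_succ]
    simpa [mul_comm] using this.symm
  rw [h1]
  simp only [Finsupp.add_apply, Finsupp.single_eq_same, h2]
  push_cast
  ring

theorem d_mul_xPow {m : ℕ} (i : Fin m) (α : Fin m →₀ ℕ) :
    d i * xPow α = xPow α * d i + (α i : ℂ) • xPow (α - Finsupp.single i 1 : Fin m →₀ ℕ) := by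
  have hm : ∀ γ : Fin m →₀ ℕ, (∏ j, (X j : MvPolynomial (Fin m) ℂ) ^ γ j) = monomial γ 1 := by
    intro γ
    rw [monomial_eq, Finsupp.prod_fintype _ _ (by simp)]
    simp
  apply Subtype.ext
  apply LinearMap.ext
  intro f
  simp only [Subalgebra.coe_mul, Subalgebra.coe_add, Subalgebra.coe_smul, Module.End.mul_apply,
    LinearMap.add_apply, LinearMap.smul_apply, xPow_apply, d_apply, hm, pderiv_mul,
    pderiv_monomial]
  rw [← smul_mul_assoc, smul_monomial, add_comm]
  simp

theorem normalOrder_surjective (m : ℕ) : Function.Surjective (normalOrder m) := by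
  set R := LinearMap.range (normalOrder m) with hR
  have mem : ∀ α β : Fin m →₀ ℕ, xPow α * dPow β ∈ R := by
    intro α β
    refine ⟨monomial (Finsupp.sumElim α β) 1, ?_⟩
    rw [normalOrder_monomial, one_smul]
    rfl
  have closed : ∀ P : weyl m, (∀ α β : Fin m →₀ ℕ, P * (xPow α * dPow β) ∈ R) →
      ∀ Q ∈ R, P * Q ∈ R := by
    rintro P hP _ ⟨q, rfl⟩
    induction q using MvPolynomial.induction_on' with
    | add p q hp hq => rw [map_add, mul_add]; exact R.add_mem hp hq
    | monomial s z =>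
      rw [normalOrder_monomial, mul_smul_comm]
      exact R.smul_mem _ (hP (Finsupp.sumFinsuppEquivProdFinsupp s).1
        (Finsupp.sumFinsuppEquivProdFinsupp s).2)
  have hx : ∀ i : Fin m, ∀ Q ∈ R, x i * Q ∈ R := fun i => closed (x i) fun α β => by
    rw [← mul_assoc, x_mul_xPow]
    exact mem _ _
  have hd : ∀ i : Fin m, ∀ Q ∈ R, d i * Q ∈ R := fun i => closed (d i) fun α β => by
    rw [← mul_assoc, d_mul_xPow, add_mul, mul_assoc, d_mul_dPow, smul_mul_assoc]
    exact R.add_mem (mem _ _) (R.smul_mem _ (mem _ _))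
  have all : ∀ P : weyl m, ∀ Q ∈ R, P * Q ∈ R := by
    intro P
    refine Algebra.adjoin_induction (p := fun P hP => ∀ Q ∈ R, (⟨P, hP⟩ : weyl m) * Q ∈ R)
      ?_ ?_ ?_ ?_ P.2
    · rintro y (⟨i, rfl⟩ | ⟨i, rfl⟩)
      · exact hx i
      · exact hd i
    · intro r Q hQ
      have h := R.smul_mem r hQ
      rw [Algebra.smul_def] at h
      exact h
    · intro y z hy hz h1 h2 Q hQ
      have h := R.add_mem (h1 Q hQ) (h2 Q hQ)
      rw [← add_mul] at h
      exact h
    · intro y z hy hz h1 h2 Q hQ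
      have h := h1 _ (h2 Q hQ)
      rw [← mul_assoc] at h
      exact h
  have one : (1 : weyl m) ∈ R := by
    have := mem 0 0
    simpa [xPow, dPow] using this
  intro P
  have h := all P 1 one
  rw [mul_one] at h
  exact h

theorem normalOrder_injective (m : ℕ) : Function.Injective (normalOrder m) := by
  rw [injective_iff_map_eq_zero]
  intro p hp
  by_contra hne
  obtain ⟨s0, hs0, hmin⟩ := Finset.exists_min_image p.support
    (fun s => (Finsupp.sumFinsuppEquivProdFinsupp s).2.degree) (support_nonempty.mpr hne)
  set β0 := (Finsupp.sumFinsuppEquivProdFinsupp s0).2 with hβ0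
  set α0 := (Finsupp.sumFinsuppEquivProdFinsupp s0).1 with hα0
  have hd : ∀ s ∈ p.support,
      (dPow (fun i => s (Sum.inr i)) : Module.End ℂ (MvPolynomial (Fin m) ℂ)) (monomial β0 1) =
        if (Finsupp.sumFinsuppEquivProdFinsupp s).2 = β0 then
          C (∏ i, (((0 + 1).ascFactorial (β0 i) : ℕ) : ℂ)) else 0 := by
    intro s hs
    have h := hmin s hs
    set β := (Finsupp.sumFinsuppEquivProdFinsupp s).2 with hβ
    change (dPow β : Module.End ℂ (MvPolynomial (Fin m) ℂ)) (monomial β0 1) = _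
    ext δ
    rw [coeff_dPow, coeff_monomial]
    by_cases hδ : β0 = δ + β
    · have hdeg : β0.degree = δ.degree + β.degree := by rw [hδ, map_add]
      have hδ0 : δ = 0 := by
        rw [← Finsupp.degree_eq_zero_iff]
        omega
      subst hδ0
      rw [zero_add] at hδ
      rw [if_pos (by rw [zero_add, hδ]), if_pos hδ.symm, coeff_C, if_pos rfl, one_mul, hδ]
      rfl
    · rw [if_neg hδ, zero_mul]
      split_ifs with hb
      · rw [coeff_C, if_neg]
        rintro rfl
        exact hδ (by rw [hb, zero_add])
      · simp
  have h0 : (normalOrder m p : Module.End ℂ (MvPolynomial (Fin m) ℂ)) (monomial β0 1) = 0 := by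
    rw [hp]; rfl
  have hcoe : (normalOrder m p : Module.End ℂ (MvPolynomial (Fin m) ℂ)) (monomial β0 1) =
      ∑ s ∈ p.support, coeff s p •
        ((∏ i, X i ^ s (Sum.inl i)) *
          (dPow (fun i => s (Sum.inr i)) : Module.End ℂ (MvPolynomial (Fin m) ℂ))
            (monomial β0 1)) := by
    conv_lhs => rw [p.as_sum, map_sum]
    rw [AddSubmonoidClass.coe_finsetSum, LinearMap.sum_apply]
    refine Finset.sum_congr rfl fun s _ => ?_
    rw [normalOrder_monomial, Subalgebra.coe_smul, LinearMap.smul_apply, Subalgebra.coe_mul,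
      Module.End.mul_apply, xPow_apply]
  have hm : ∀ s : Fin m ⊕ Fin m →₀ ℕ,
      (∏ j, (X j : MvPolynomial (Fin m) ℂ) ^ s (Sum.inl j)) =
        monomial (Finsupp.sumFinsuppEquivProdFinsupp s).1 1 := by
    intro s
    rw [monomial_eq, Finsupp.prod_fintype _ _ (by simp)]
    simp
  have hc := congrArg (coeff α0) (hcoe.symm.trans h0)
  rw [coeff_sum, Finset.sum_eq_single s0] at hc
  · rw [hd s0 hs0, if_pos rfl, hm, coeff_smul, mul_comm, coeff_C_mul, coeff_monomial, if_pos rfl, mul_one,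
      coeff_zero, smul_eq_mul, mul_eq_zero] at hc
    rcases hc with hc | hc
    · exact (mem_support_iff.mp hs0) hc
    · rw [Finset.prod_eq_zero_iff] at hc
      obtain ⟨i, _, hi⟩ := hc
      exact (Nat.ascFactorial_pos 0 (β0 i)).ne' (by exact_mod_cast hi)
  · intro s hs hss
    rw [hd s hs, hm, coeff_smul]
    split_ifs with hb
    · rw [mul_comm, coeff_C_mul, coeff_monomial, if_neg, mul_zero, smul_zero]
      intro ha
      exact hss (Finsupp.sumFinsuppEquivProdFinsupp.injective (Prod.ext ha hb))
    · simp
  · intro h; exact absurd hs0 h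

/-- The total symbol `∑ c_{αβ} x^α ∂^β ↦ ∑ c_{αβ} x^α ξ^β`, the inverse of `normalOrder`. -/
def totalSymbol (m : ℕ) : weyl m ≃ₗ[ℂ] MvPolynomial (Fin m ⊕ Fin m) ℂ :=
  (LinearEquiv.ofBijective (normalOrder m)
    ⟨normalOrder_injective m, normalOrder_surjective m⟩).symm

/-! ### Characteristic variety and singular locus -/

/-- The weight vector `(𝟎, 𝟏)`: every `xᵢ` has weight `0` and every `ξᵢ` has weight `1`. -/
def weight01 (m : ℕ) : Fin m ⊕ Fin m → ℕ := Sum.elim (fun _ => 0) (fun _ => 1)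

/-- The initial form `in_(𝟎,𝟏)(P)`: the sum of the terms of highest weight of the total symbol. -/
def initialForm {m : ℕ} (P : weyl m) : MvPolynomial (Fin m ⊕ Fin m) ℂ :=
  weightedHomogeneousComponent (weight01 m)
    (weightedTotalDegree (weight01 m) (totalSymbol m P)) (totalSymbol m P)

/-- The initial form ideal `in_(𝟎,𝟏)(I) = ⟨in_(𝟎,𝟏)(P) ∣ P ∈ I⟩ ⊆ ℂ[x, ξ]`. -/
def initialIdeal {m : ℕ} (I : Ideal (weyl m)) : Ideal (MvPolynomial (Fin m ⊕ Fin m) ℂ) :=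
  Ideal.span {f | ∃ P ∈ I, f = initialForm P}

/-- The characteristic variety `Ch(I) = V(in_(𝟎,𝟏)(I)) ⊆ ℂ²ᵐ`. -/
def charVariety {m : ℕ} (I : Ideal (weyl m)) : Set (Fin m ⊕ Fin m → ℂ) :=
  zeroLocus ℂ (initialIdeal I)

/-- The singular locus `Sing(I) = π(Ch(I) \ {ξ₁ = ⋯ = ξₘ = 0})`, with `π(x, ξ) = x`. -/
def singularLocus {m : ℕ} (I : Ideal (weyl m)) : Set (Fin m → ℂ) :=
  (fun p i => p (Sum.inl i)) '' (charVariety I \ {p | ∀ i, p (Sum.inr i) = 0})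

/-- The polynomial
`x₁⋯xₘ · ∏ᵢ (1 - xᵢ) · ∏_{i<j} (xᵢxⱼ - xᵢ - xⱼ) ⋯ (x₁⋯xₘ - ∑ₖ ∏_{l≠k} x_l)`,
with one factor `∏_{i∈S} xᵢ - ∑_{k∈S} ∏_{l∈S, l≠k} x_l` for each subset `S` of size at least two. -/
def singPolyB (m : ℕ) : MvPolynomial (Fin m) ℂ :=
  (∏ i, X i) * (∏ i, (1 - X i)) *
    ∏ S : Finset (Fin m) with 2 ≤ S.card, ((∏ i ∈ S, X i) - ∑ k ∈ S, ∏ l ∈ S.erase k, X l)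

end Lauricella

end

/-! The order-two symbols of the operators are `symbolB i`, that is uᵢ = xᵢξᵢ(∑ⱼ xⱼξⱼ - xᵢ²ξᵢ). The
crux is that they generate the whole initial ideal, for all parameters (`initialIdeal_idealB`); the
rest is elementary algebra.

An initial form could escape the ideal (uᵢ) only through cancellation of leading terms in ∑ Bᵢℓᵢ,
that is through a relation among the uᵢ. Two facts exclude this. First, all relations among the uᵢ
are Koszul (`koszulExact_symbolB`): in the grading by x-degree the top part of uᵢ is -xᵢ³ξᵢ², and
these monomials have pairwise disjoint supports. Second, each Koszul relation lifts to an exact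
identity in D, (ℓⱼ - θⱼ)ℓᵢ = (ℓᵢ - θᵢ)ℓⱼ (`ellB_relation`), where ℓᵢ - θᵢ still has symbol uᵢ.
Subtracting lifted relations lowers the order of the Bᵢ until nothing cancels (`KoszulExact.lift`).

Over a point y the question is then whether uᵢ(y, ξ) = 0 for all i has a solution ξ ≠ 0. If some yᵢ
= 0, the i-th unit vector is one. Otherwise, with s = ∑ yⱼξⱼ, each ξᵢ is 0 or s/yᵢ², and summing
yᵢξᵢ over the support S of ξ gives ∑_{i∈S} 1/yᵢ = 1; clearing denominators gives the factor of the
polynomial attached to S (`exists_covector_iff`). -/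

noncomputable section

namespace Lauricella

/-! ### Lifting Koszul syzygies along a weight filtration -/

section Filtration

variable {σ : Type*}

/-- The polynomials all of whose monomials have weight less than `n`. -/
def ltWeight (w : σ → ℕ) (n : ℕ) : Submodule ℂ (MvPolynomial σ ℂ) :=
  restrictSupport ℂ {s | Finsupp.weight w s < n}

theorem mem_ltWeight {w : σ → ℕ} {n : ℕ} {p : MvPolynomial σ ℂ} :
    p ∈ ltWeight w n ↔ ∀ s, coeff s p ≠ 0 → Finsupp.weight w s < n := by
  rw [ltWeight, mem_restrictSupport_iff, Set.subset_def]
  simp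

theorem ltWeight_mono (w : σ → ℕ) {k n : ℕ} (h : k ≤ n) : ltWeight w k ≤ ltWeight w n :=
  fun _ hp => mem_ltWeight.2 fun s hs => (mem_ltWeight.1 hp s hs).trans_le h

theorem eq_zero_of_mem_ltWeight_zero {w : σ → ℕ} {p : MvPolynomial σ ℂ}
    (h : p ∈ ltWeight w 0) : p = 0 := by
  ext s
  by_contra hs
  exact Nat.not_lt_zero _ (mem_ltWeight.1 h s (by simpa using hs))

theorem mul_mem_ltWeight {w : σ → ℕ} {k l : ℕ} {p q : MvPolynomial σ ℂ}
    (hp : p ∈ ltWeight w (k + 1)) (hq : q ∈ ltWeight w l) : p * q ∈ ltWeight w (k + l) := by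
  classical
  rw [mem_ltWeight]
  intro s hs
  rw [coeff_mul] at hs
  obtain ⟨⟨a, b⟩, hab, h⟩ := Finset.exists_ne_zero_of_sum_ne_zero hs
  rw [Finset.HasAntidiagonal.mem_antidiagonal] at hab
  have ha := mem_ltWeight.1 hp a (left_ne_zero_of_mul h)
  have hb := mem_ltWeight.1 hq b (right_ne_zero_of_mul h)
  dsimp only at hab
  rw [← hab, map_add]
  omega

theorem mul_mem_ltWeight_succ {w : σ → ℕ} {k l : ℕ} {p q : MvPolynomial σ ℂ}
    (hp : p ∈ ltWeight w (k + 1)) (hq : q ∈ ltWeight w (l + 1)) :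
    p * q ∈ ltWeight w (k + l + 1) :=
  mul_mem_ltWeight (k := k) (l := l + 1) hp hq

theorem IsWeightedHomogeneous.mem_ltWeight_succ {w : σ → ℕ} {k : ℕ} {p : MvPolynomial σ ℂ}
    (hp : IsWeightedHomogeneous w p k) : p ∈ ltWeight w (k + 1) :=
  mem_ltWeight.2 fun _ hs => (hp hs).trans_lt k.lt_succ_self

theorem IsWeightedHomogeneous.eq_zero_of_mem_ltWeight {w : σ → ℕ} {k : ℕ} {p : MvPolynomial σ ℂ}
    (hp : IsWeightedHomogeneous w p k) (h : p ∈ ltWeight w k) : p = 0 := by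
  ext s
  by_contra hs
  have hs' : coeff s p ≠ 0 := by simpa using hs
  exact (mem_ltWeight.1 h s hs').ne (hp hs')

theorem sub_component_mem_ltWeight {w : σ → ℕ} {k : ℕ} {p : MvPolynomial σ ℂ}
    (hp : p ∈ ltWeight w (k + 1)) : p - weightedHomogeneousComponent w k p ∈ ltWeight w k := by
  classical
  refine mem_ltWeight.2 fun s hs => ?_
  rw [coeff_sub, coeff_weightedHomogeneousComponent] at hs
  split_ifs at hs with h
  · simp at hs
  · rw [sub_zero] at hs
    have := mem_ltWeight.1 hp s hs
    omega

theorem mem_ltWeight_weightedTotalDegree (w : σ → ℕ) (p : MvPolynomial σ ℂ) :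
    p ∈ ltWeight w (weightedTotalDegree w p + 1) :=
  mem_ltWeight.2 fun _ hs =>
    Nat.lt_succ_of_le (le_weightedTotalDegree w (mem_support_iff.2 hs))

theorem component_eq_of_sub_mem {w : σ → ℕ} {k : ℕ} {p q : MvPolynomial σ ℂ}
    (hq : IsWeightedHomogeneous w q k) (h : p - q ∈ ltWeight w k) :
    weightedHomogeneousComponent w k p = q := by
  have h0 : weightedHomogeneousComponent w k (p - q) = 0 := by
    apply weightedHomogeneousComponent_eq_zero'
    intro s hs
    exact (mem_ltWeight.1 h s (mem_support_iff.1 hs)).ne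
  rw [map_sub, sub_eq_zero] at h0
  rw [h0, hq.weightedHomogeneousComponent_same]

/-- Used to replace the coefficients of a Koszul relation by homogeneous ones. -/
theorem component_mul {w : σ → ℕ} {e : ℕ} {u : MvPolynomial σ ℂ}
    (hu : IsWeightedHomogeneous w u e) (k : ℕ) (p : MvPolynomial σ ℂ) :
    weightedHomogeneousComponent w k (p * u) =
      if e ≤ k then weightedHomogeneousComponent w (k - e) p * u else 0 := by
  classical
  induction p using MvPolynomial.induction_on' with
  | add p q hp hq =>
    rw [add_mul, map_add, hp, hq]
    split_ifs
    · rw [map_add, add_mul]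
    · rw [add_zero]
  | monomial s z =>
    have hs : IsWeightedHomogeneous w (monomial s z) (Finsupp.weight w s) :=
      isWeightedHomogeneous_monomial w s z rfl
    rw [weightedHomogeneousComponent_of_mem (hs.mul hu), weightedHomogeneousComponent_of_mem hs]
    by_cases he : e ≤ k
    · rw [if_pos he, ite_mul, zero_mul]
      refine if_congr ?_ rfl rfl
      omega
    · rw [if_neg he, if_neg]
      omega

/-- `p` represents the part of weight `k` of an element `P` of weight at most `k`. -/
def HasSymbol {A : Type*} (w : σ → ℕ) (T : A → MvPolynomial σ ℂ) (k : ℕ) (P : A)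
    (p : MvPolynomial σ ℂ) : Prop :=
  p ∈ ltWeight w (k + 1) ∧ T P - p ∈ ltWeight w k

/-- The relations among the `u i` are generated by the relations `u j * u i = u i * u j`. -/
def KoszulExact {ι : Type*} [Fintype ι] (u : ι → MvPolynomial σ ℂ) : Prop :=
  ∀ g : ι → MvPolynomial σ ℂ, ∑ i, g i * u i = 0 →
    ∃ h : ι → ι → MvPolynomial σ ℂ, (∀ i j, h i j = -h j i) ∧ ∀ i, g i = ∑ j, h i j * u j

/-- An additive identification of a ring of operators with a space of polynomials. -/
abbrev SymbolEquiv (A : Type*) [Ring A] (σ : Type*) := A ≃+ MvPolynomial σ ℂ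

variable {A : Type*} [Ring A] {w : σ → ℕ} {T : SymbolEquiv A σ}

theorem HasSymbol.mem {A : Type*} {T : A → MvPolynomial σ ℂ} {k : ℕ} {P : A}
    {p : MvPolynomial σ ℂ} (h : HasSymbol w T k P p) :
    T P ∈ ltWeight w (k + 1) := by
  have := (ltWeight w (k + 1)).add_mem (ltWeight_mono w k.le_succ h.2) h.1
  rwa [sub_add_cancel] at this

theorem HasSymbol.sum {ι : Type*} {s : Finset ι} {k : ℕ} {P : ι → A}
    {p : ι → MvPolynomial σ ℂ} (h : ∀ i ∈ s, HasSymbol w T k (P i) (p i)) :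
    HasSymbol w T k (∑ i ∈ s, P i) (∑ i ∈ s, p i) := by
  refine ⟨Submodule.sum_mem _ fun i hi => (h i hi).1, ?_⟩
  rw [map_sum, ← Finset.sum_sub_distrib]
  exact Submodule.sum_mem _ fun i hi => (h i hi).2

theorem HasSymbol.add {k : ℕ} {P Q : A} {p q : MvPolynomial σ ℂ} (hP : HasSymbol w T k P p)
    (hQ : HasSymbol w T k Q q) : HasSymbol w T k (P + Q) (p + q) := by
  refine ⟨Submodule.add_mem _ hP.1 hQ.1, ?_⟩
  rw [map_add, add_sub_add_comm]
  exact Submodule.add_mem _ hP.2 hQ.2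

theorem HasSymbol.sub {k : ℕ} {P Q : A} {p q : MvPolynomial σ ℂ} (hP : HasSymbol w T k P p)
    (hQ : HasSymbol w T k Q q) : HasSymbol w T k (P - Q) (p - q) := by
  refine ⟨Submodule.sub_mem _ hP.1 hQ.1, ?_⟩
  rw [map_sub, sub_sub_sub_comm]
  exact Submodule.sub_mem _ hP.2 hQ.2

theorem hasSymbol_zero_iff {k : ℕ} {P : A} : HasSymbol w T k P 0 ↔ T P ∈ ltWeight w k := by
  simp [HasSymbol]

theorem HasSymbol.add_lower {k : ℕ} {P Q : A} {p : MvPolynomial σ ℂ} (hP : HasSymbol w T k P p)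
    (hQ : T Q ∈ ltWeight w k) : HasSymbol w T k (P + Q) p := by
  simpa using hP.add (hasSymbol_zero_iff.2 hQ)

theorem hasSymbol_component {k : ℕ} {P : A} (h : T P ∈ ltWeight w (k + 1)) :
    HasSymbol w T k P (weightedHomogeneousComponent w k (T P)) :=
  ⟨IsWeightedHomogeneous.mem_ltWeight_succ (weightedHomogeneousComponent_isWeightedHomogeneous ..),
    sub_component_mem_ltWeight h⟩

theorem hasSymbol_symm {k : ℕ} {p : MvPolynomial σ ℂ} (h : p ∈ ltWeight w (k + 1)) :
    HasSymbol w T k (T.symm p) p :=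
  ⟨h, by simp⟩

/-- Symbols of products are products of symbols. -/
def SymbolMul (w : σ → ℕ) (T : A → MvPolynomial σ ℂ) : Prop :=
  ∀ (k l : ℕ) (P Q : A) (p q : MvPolynomial σ ℂ), HasSymbol w T k P p → HasSymbol w T l Q q →
    HasSymbol w T (k + l) (P * Q) (p * q)

/-- Exchanging i and j turns the double sum into its negative. Since `A` is only a ring, division by
2 takes place after transport along `T`. -/
theorem sum_sum_eq_zero_of_antisymm (T : SymbolEquiv A σ) {ι : Type*} [Fintype ι]
    {H : ι → ι → A} {L L' : ι → A}
    (hH : ∀ i j, H i j = -H j i) (hL : ∀ i j, L' j * L i = L' i * L j) :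
    ∑ i, (∑ j, H i j * L' j) * L i = 0 := by
  have h : ∑ i, ∑ j, H i j * (L' j * L i) = -∑ i, ∑ j, H i j * (L' j * L i) := by
    conv_lhs => rw [Finset.sum_comm]
    simp only [← Finset.sum_neg_distrib, ← neg_mul]
    refine Finset.sum_congr rfl fun j _ => Finset.sum_congr rfl fun i _ => ?_
    rw [hH i j, hL i j]
  replace h := congrArg T h
  rw [map_neg, eq_neg_iff_add_eq_zero, ← two_smul ℂ, smul_eq_zero_iff_right two_ne_zero,
    map_eq_zero_iff T T.injective] at h
  simpa only [Finset.sum_mul, mul_assoc] using h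

/-- If the symbols of the `L i` have only Koszul relations, then a combination of the `L i` of
small weight differs by a Koszul relation from one with coefficients of small weight. -/
theorem KoszulExact.lift {ι : Type*} [Fintype ι] (hT : SymbolMul w T) {e : ℕ}
    {u : ι → MvPolynomial σ ℂ} (hu : ∀ i, IsWeightedHomogeneous w (u i) e) (hK : KoszulExact u)
    {L L' : ι → A} (hL : ∀ i, HasSymbol w T e (L i) (u i))
    (hL' : ∀ i, HasSymbol w T e (L' i) (u i)) (hc : ∀ i j, L' j * L i = L' i * L j)
    {n : ℕ} (B : ι → A) (hB : T (∑ i, B i * L i) ∈ ltWeight w n) :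
    ∃ H : ι → ι → A, (∀ i j, H i j = -H j i) ∧
      ∀ i, T (B i - ∑ j, H i j * L' j) ∈ ltWeight w (n - e) := by
  classical
  -- Induction on a common weight bound `k` for the coefficients.
  obtain ⟨k, hk⟩ : ∃ k, ∀ i, T (B i) ∈ ltWeight w k := by
    refine ⟨Finset.univ.sup fun i => weightedTotalDegree w (T (B i)) + 1, fun i => ?_⟩
    exact ltWeight_mono w (Finset.le_sup (f := fun i => weightedTotalDegree w (T (B i)) + 1)
      (Finset.mem_univ i)) (mem_ltWeight_weightedTotalDegree w _)
  induction k generalizing B with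
  | zero =>
    refine ⟨0, by simp, fun i => ?_⟩
    simpa using ltWeight_mono w (Nat.zero_le _) (hk i)
  | succ k ih =>
    by_cases hkn : k + 1 ≤ n - e
    · refine ⟨0, by simp, fun i => ?_⟩
      simpa using ltWeight_mono w hkn (hk i)
    set g := fun i => weightedHomogeneousComponent w k (T (B i)) with hg
    have hgh : ∀ i, IsWeightedHomogeneous w (g i) k := fun i =>
      weightedHomogeneousComponent_isWeightedHomogeneous ..
    have hBg : ∀ i, HasSymbol w T k (B i) (g i) := fun i => hasSymbol_component (hk i)
    -- Here n ≤ k + e, so the sum ∑ B i * L i has no part of weight k + e; that part is ∑ g i * u i.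
    have hsum : ∑ i, g i * u i = 0 := by
      have hs : HasSymbol w T (k + e) (∑ i, B i * L i) (∑ i, g i * u i) :=
        HasSymbol.sum fun i _ => hT _ _ _ _ _ _ (hBg i) (hL i)
      refine IsWeightedHomogeneous.eq_zero_of_mem_ltWeight
        (IsWeightedHomogeneous.sum _ _ (k + e) fun i _ => (hgh i).mul (hu i)) ?_
      have := Submodule.sub_mem _ (ltWeight_mono w (by omega : n ≤ k + e) hB) hs.2
      rwa [sub_sub_cancel] at this
    obtain ⟨h, hanti, hgu⟩ := hK g hsum
    -- Only the part of `h` of weight k - e contributes in weight k. If e > k nothing does, while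
    -- truncated subtraction would select weight 0.
    set h' : ι → ι → MvPolynomial σ ℂ := fun i j =>
      if e ≤ k then weightedHomogeneousComponent w (k - e) (h i j) else 0 with hh'
    have hgu' : ∀ i, g i = ∑ j, h' i j * u j := by
      intro i
      have := congrArg (weightedHomogeneousComponent w k) (hgu i)
      rw [(hgh i).weightedHomogeneousComponent_same, map_sum] at this
      rw [this]
      refine Finset.sum_congr rfl fun j _ => ?_
      rw [component_mul (hu j), hh']
      split_ifs <;> simp
    have hanti' : ∀ i j, T.symm (h' i j) = -T.symm (h' j i) := by
      intro i j
      rw [← map_neg]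
      congr 1
      simp only [hh']
      rw [hanti i j]
      split_ifs <;> simp
    have hsym : ∀ i, HasSymbol w T k (∑ j, T.symm (h' i j) * L' j) (g i) := by
      intro i
      rw [hgu' i]
      refine HasSymbol.sum fun j _ => ?_
      by_cases hek : e ≤ k
      · have : HasSymbol w T (k - e) (T.symm (h' i j)) (h' i j) := by
          refine hasSymbol_symm ?_
          simp only [hh', if_pos hek]
          exact IsWeightedHomogeneous.mem_ltWeight_succ
            (weightedHomogeneousComponent_isWeightedHomogeneous ..)
        simpa [Nat.sub_add_cancel hek] using hT _ _ _ _ _ _ this (hL' j)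
      · simp [hh', hek, hasSymbol_zero_iff]
    -- Subtracting the lifted Koszul relation leaves ∑ B i * L i unchanged and cancels the leading
    -- parts `g i`.
    obtain ⟨H, hH, hHB⟩ := ih (fun i => B i - ∑ j, T.symm (h' i j) * L' j)
      (by
        have := sum_sum_eq_zero_of_antisymm T (L := L) (L' := L') hanti' hc
        simpa only [sub_mul, Finset.sum_sub_distrib, this, sub_zero] using hB)
      (fun i => hasSymbol_zero_iff.1 (by simpa using (hBg i).sub (hsym i)))
    refine ⟨fun i j => T.symm (h' i j) + H i j, fun i j => ?_, fun i => ?_⟩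
    · change T.symm (h' i j) + H i j = -(T.symm (h' j i) + H j i)
      rw [hanti', hH i j, neg_add]
    · simpa only [add_mul, Finset.sum_add_distrib, sub_sub] using hHB i

/-- If the symbols of the `L i` have only Koszul relations, then a combination of the `L i` of
small weight can be written with coefficients of small weight. -/
theorem KoszulExact.exists_coeff_mem_ltWeight {ι : Type*} [Fintype ι] (hT : SymbolMul w T) {e : ℕ}
    {u : ι → MvPolynomial σ ℂ} (hu : ∀ i, IsWeightedHomogeneous w (u i) e) (hK : KoszulExact u)
    {L L' : ι → A} (hL : ∀ i, HasSymbol w T e (L i) (u i))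
    (hL' : ∀ i, HasSymbol w T e (L' i) (u i)) (hc : ∀ i j, L' j * L i = L' i * L j)
    {n : ℕ} (B : ι → A) (hB : T (∑ i, B i * L i) ∈ ltWeight w n) :
    ∃ B' : ι → A, ∑ i, B i * L i = ∑ i, B' i * L i ∧ ∀ i, T (B' i) ∈ ltWeight w (n - e) := by
  obtain ⟨H, hH, hHB⟩ := hK.lift hT hu hL hL' hc B hB
  refine ⟨_, ?_, hHB⟩
  simp only [sub_mul, Finset.sum_sub_distrib, sum_sum_eq_zero_of_antisymm T hH hc, sub_zero]

theorem mul_sub_mul_mem_ltWeight {k l : ℕ} {P Q p q : MvPolynomial σ ℂ}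
    (hP : P ∈ ltWeight w (k + 1)) (hPp : P - p ∈ ltWeight w k) (hq : q ∈ ltWeight w (l + 1))
    (hQq : Q - q ∈ ltWeight w l) : P * Q - p * q ∈ ltWeight w (k + l) := by
  have e : P * Q - p * q = P * (Q - q) + q * (P - p) := by ring
  rw [e]
  refine Submodule.add_mem _ (mul_mem_ltWeight hP hQq) ?_
  rw [add_comm k l]
  exact mul_mem_ltWeight hq hPp

theorem symbolMul_refl (w : σ → ℕ) : SymbolMul w (AddEquiv.refl (MvPolynomial σ ℂ)) :=
  fun _ _ _ _ _ _ hP hQ => ⟨mul_mem_ltWeight_succ hP.1 hQ.1,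
    mul_sub_mul_mem_ltWeight hP.mem hP.2 hQ.1 hQ.2⟩

/-- Koszul exactness may be checked on the parts of highest weight. -/
theorem KoszulExact.of_symbol {ι : Type*} [Fintype ι] {e : ℕ}
    {u f : ι → MvPolynomial σ ℂ} (hu : ∀ i, IsWeightedHomogeneous w (u i) e) (hK : KoszulExact u)
    (hf : ∀ i, f i - u i ∈ ltWeight w e) : KoszulExact f := by
  intro g hg
  have hL : ∀ i, HasSymbol w (AddEquiv.refl (MvPolynomial σ ℂ)) e (f i) (u i) := fun i =>
    ⟨IsWeightedHomogeneous.mem_ltWeight_succ (hu i), hf i⟩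
  -- The lifting applies to the polynomial ring itself, with `L = L' = f`. With n = 0 the remainders
  -- lie in weight below 0, hence vanish.
  obtain ⟨H, hH, h⟩ := hK.lift (symbolMul_refl w) hu hL hL (fun i j => mul_comm _ _) (n := 0) g
    (by rw [hg]; simp)
  refine ⟨H, hH, fun i => ?_⟩
  have := eq_zero_of_mem_ltWeight_zero (by simpa using h i)
  exact sub_eq_zero.1 this

end Filtration

/-! ### Monomials with disjoint supports -/

/-- Monomials with pairwise disjoint supports have only Koszul relations. -/
theorem koszulExact_monomial {σ ι : Type*} [Fintype ι] (t : ι → σ →₀ ℕ) (z : ι → ℂ)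
    (hz : ∀ i, z i ≠ 0) (ht : ∀ i j, i ≠ j → Disjoint (t i).support (t j).support) :
    KoszulExact fun i => monomial (t i) (z i) := by
  classical
  have key : ∀ (s : Finset ι) (g : ι → MvPolynomial σ ℂ),
      ∑ i ∈ s, g i * monomial (t i) (z i) = 0 →
      ∃ h : ι → ι → MvPolynomial σ ℂ, (∀ i j, h i j = -h j i) ∧
        ∀ i ∈ s, g i = ∑ j ∈ s, h i j * monomial (t j) (z j) := by
    intro s
    induction s using Finset.induction_on with
    | empty => exact fun g _ => ⟨0, by simp⟩
    | insert a s ha ih =>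
      intro g hg
      rw [Finset.sum_insert ha] at hg
      -- The relation puts `g a` times the monomial of `a` in the monomial ideal of the others; by
      -- disjointness `g a` itself lies there.
      obtain ⟨k, hk⟩ : ∃ k : ι → MvPolynomial σ ℂ,
          g a = ∑ j ∈ s, k j * monomial (t j) (z j) := by
        have hmem : ∀ q : MvPolynomial σ ℂ,
            (∃ k : ι → MvPolynomial σ ℂ, q = ∑ j ∈ s, k j * monomial (t j) (z j)) ↔
              ∀ v ∈ q.support, ∃ si ∈ t '' s, si ≤ v := by
          intro q
          have hspan : Ideal.span ((fun v => monomial v (1 : ℂ)) '' (t '' s)) =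
              Ideal.span ((fun j => monomial (t j) (z j)) '' (s : Set ι)) := by
            rw [Set.image_image]
            apply le_antisymm <;> rw [Ideal.span_le] <;> rintro _ ⟨j, hj, rfl⟩
            · have : monomial (t j) (1 : ℂ) = C (z j)⁻¹ * monomial (t j) (z j) := by
                rw [C_mul_monomial, inv_mul_cancel₀ (hz j)]
              simp only [SetLike.mem_coe]
              rw [this]
              exact Ideal.mul_mem_left _ _ (Ideal.subset_span ⟨j, hj, rfl⟩)
            · have : monomial (t j) (z j) = C (z j) * monomial (t j) 1 := by
                rw [C_mul_monomial, mul_one]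
              simp only [SetLike.mem_coe]
              rw [this]
              exact Ideal.mul_mem_left _ _ (Ideal.subset_span ⟨j, hj, rfl⟩)
          rw [← mem_ideal_span_monomial_image, hspan, Submodule.mem_span_image_finset_iff_exists_fun']
          simp [eq_comm]
        rw [hmem]
        intro v hv
        have hsum : ∀ v ∈ (g a * monomial (t a) (z a)).support, ∃ si ∈ t '' s, si ≤ v := by
          rw [← hmem]
          refine ⟨fun j => -g j, ?_⟩
          rw [eq_neg_of_add_eq_zero_left hg, ← Finset.sum_neg_distrib]
          simp
        -- Since `t a` vanishes on the support of `t j`, the inequality t j ≤ v + t a gives t j ≤ v.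
        obtain ⟨_, ⟨j, hj, rfl⟩, hle⟩ := hsum (v + t a) (by
          rw [mem_support_iff, coeff_mul_monomial]
          exact mul_ne_zero (mem_support_iff.1 hv) (hz a))
        refine ⟨_, ⟨j, hj, rfl⟩, fun b => ?_⟩
        by_cases hb : b ∈ (t j).support
        · have hja : j ≠ a := fun h => ha (h ▸ hj)
          have := Finset.disjoint_left.1 (ht j a hja) hb
          simpa [Finsupp.notMem_support_iff.1 this] using hle b
        · simp [Finsupp.notMem_support_iff.1 hb]
      -- Substituting the expression for `g a` gives a relation over `s` alone.
      obtain ⟨h, h1, h3⟩ := ih (fun j => g j + k j * monomial (t a) (z a)) (by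
        rw [← hg, hk, Finset.sum_mul, add_comm, ← Finset.sum_add_distrib]
        exact Finset.sum_congr rfl fun j _ => by ring)
      -- The matrix on `s` is bordered by the row `k` and the column `-k` at `a`.
      refine ⟨fun i j => if i = a then (if j ∈ s then k j else 0)
        else if j = a then (if i ∈ s then -k i else 0) else h i j, ?_, ?_⟩
      · intro i j
        by_cases hi : i = a <;> by_cases hj : j = a
        · simp [hi, hj, ha]
        · subst hi; by_cases hjs : j ∈ s <;> simp [hj, hjs]
        · subst hj; by_cases his : i ∈ s <;> simp [hi, his]
        · simp [hi, hj, h1 i j]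
      · intro i hi
        rw [Finset.sum_insert ha]
        by_cases hia : i = a
        · subst hia
          simp only [if_true, ha, if_false, zero_mul, zero_add]
          rw [hk]
          exact Finset.sum_congr rfl fun j hj => by rw [if_pos hj]
        · have his : i ∈ s := Finset.mem_of_mem_insert_of_ne hi hia
          have e : ∑ j ∈ s, (if i = a then (if j ∈ s then k j else 0)
              else if j = a then (if i ∈ s then -k i else 0) else h i j) * monomial (t j) (z j) =
              ∑ j ∈ s, h i j * monomial (t j) (z j) := by
            refine Finset.sum_congr rfl fun j hj => ?_
            rw [if_neg hia, if_neg (ne_of_mem_of_not_mem hj ha)]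
          rw [e, ← h3 i his]
          simp only [if_neg hia, if_pos his, if_true]
          ring
  intro g hg
  obtain ⟨h, h1, h3⟩ := key Finset.univ g hg
  exact ⟨h, h1, fun i => h3 i (Finset.mem_univ i)⟩

/-! ### The order filtration of the Weyl algebra -/

variable {m : ℕ}

theorem totalSymbol_normalOrder (p : MvPolynomial (Fin m ⊕ Fin m) ℂ) :
    totalSymbol m (normalOrder m p) = p :=
  (LinearEquiv.ofBijective (normalOrder m)
    ⟨normalOrder_injective m, normalOrder_surjective m⟩).symm_apply_apply p

theorem normalOrder_totalSymbol (P : weyl m) : normalOrder m (totalSymbol m P) = P :=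
  (LinearEquiv.ofBijective (normalOrder m)
    ⟨normalOrder_injective m, normalOrder_surjective m⟩).apply_symm_apply P

theorem normalOrder_monomial_sumElim (α β : Fin m →₀ ℕ) (z : ℂ) :
    normalOrder m (monomial (Finsupp.sumElim α β) z) = z • (xPow α * dPow β) :=
  normalOrder_monomial _ _

theorem exists_eq_sumElim (s : Fin m ⊕ Fin m →₀ ℕ) :
    ∃ α β : Fin m →₀ ℕ, s = Finsupp.sumElim α β :=
  ⟨_, _, (Finsupp.sumFinsuppEquivProdFinsupp.symm_apply_apply s).symm⟩

theorem sumElim_add_single_inl (α β : Fin m →₀ ℕ) (i : Fin m) (n : ℕ) :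
    Finsupp.sumElim (α + Finsupp.single i n) β =
      Finsupp.sumElim α β + Finsupp.single (Sum.inl i) n := by
  ext (j | j) <;> simp [Finsupp.single_apply]

theorem sumElim_add_single_inr (α β : Fin m →₀ ℕ) (i : Fin m) (n : ℕ) :
    Finsupp.sumElim α (β + Finsupp.single i n) =
      Finsupp.sumElim α β + Finsupp.single (Sum.inr i) n := by
  ext (j | j) <;> simp [Finsupp.single_apply]

theorem sumElim_sub_single_inl (α β : Fin m →₀ ℕ) (i : Fin m) (n : ℕ) :
    Finsupp.sumElim (α - Finsupp.single i n) β =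
      Finsupp.sumElim α β - Finsupp.single (Sum.inl i) n := by
  ext (j | j) <;> simp [Finsupp.single_apply]

theorem monomial_mul_X_eq {σ : Type*} (s : σ →₀ ℕ) (z : ℂ) (i : σ) :
    monomial s z * X i = monomial (s + Finsupp.single i 1) z := by
  rw [X, monomial_mul, mul_one]

theorem x_mul_normalOrder (i : Fin m) (q : MvPolynomial (Fin m ⊕ Fin m) ℂ) :
    x i * normalOrder m q = normalOrder m (X (Sum.inl i) * q) := by
  induction q using MvPolynomial.induction_on' with
  | add p q hp hq => simp only [map_add, mul_add, hp, hq]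
  | monomial s z =>
    obtain ⟨α, β, rfl⟩ := exists_eq_sumElim s
    rw [mul_comm (X _), monomial_mul_X_eq, ← sumElim_add_single_inl, normalOrder_monomial_sumElim,
      normalOrder_monomial_sumElim, mul_smul_comm, ← mul_assoc, x_mul_xPow]

/-- The derivative term is the commutator of ∂ᵢ with x^α. It does not raise the order, which is why
symbols multiply. -/
theorem d_mul_normalOrder (i : Fin m) (q : MvPolynomial (Fin m ⊕ Fin m) ℂ) :
    d i * normalOrder m q =
      normalOrder m (X (Sum.inr i) * q + pderiv (Sum.inl i) q) := by
  induction q using MvPolynomial.induction_on' with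
  | add p q hp hq =>
    simp only [map_add, mul_add] at hp hq ⊢
    rw [hp, hq]
    abel
  | monomial s z =>
    obtain ⟨α, β, rfl⟩ := exists_eq_sumElim s
    rw [mul_comm (X _), monomial_mul_X_eq, ← sumElim_add_single_inr, pderiv_monomial,
      ← sumElim_sub_single_inl, map_add, normalOrder_monomial_sumElim,
      normalOrder_monomial_sumElim, normalOrder_monomial_sumElim, mul_smul_comm, ← mul_assoc,
      d_mul_xPow, add_mul, mul_assoc, d_mul_dPow, smul_add, smul_mul_assoc, mul_smul]
    simp

theorem totalSymbol_x_mul (i : Fin m) (Q : weyl m) :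
    totalSymbol m (x i * Q) = X (Sum.inl i) * totalSymbol m Q := by
  conv_lhs => rw [← normalOrder_totalSymbol Q]
  rw [x_mul_normalOrder, totalSymbol_normalOrder]

theorem totalSymbol_d_mul (i : Fin m) (Q : weyl m) :
    totalSymbol m (d i * Q) =
      X (Sum.inr i) * totalSymbol m Q + pderiv (Sum.inl i) (totalSymbol m Q) := by
  conv_lhs => rw [← normalOrder_totalSymbol Q]
  rw [d_mul_normalOrder, totalSymbol_normalOrder]

theorem totalSymbol_one : totalSymbol m 1 = 1 := by
  have h : normalOrder m 1 = 1 := by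
    have := normalOrder_monomial_sumElim (0 : Fin m →₀ ℕ) 0 1
    simpa [xPow, dPow] using this
  rw [← h, totalSymbol_normalOrder]

theorem totalSymbol_algebraMap (z : ℂ) : totalSymbol m (algebraMap ℂ (weyl m) z) = C z := by
  rw [Algebra.algebraMap_eq_smul_one, map_smul, totalSymbol_one, smul_eq_C_mul, mul_one]

theorem X_inl_mem_ltWeight (i : Fin m) :
    (X (Sum.inl i) : MvPolynomial (Fin m ⊕ Fin m) ℂ) ∈ ltWeight (weight01 m) (0 + 1) :=
  IsWeightedHomogeneous.mem_ltWeight_succ (isWeightedHomogeneous_X ℂ (weight01 m) (Sum.inl i))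

theorem X_inr_mem_ltWeight (i : Fin m) :
    (X (Sum.inr i) : MvPolynomial (Fin m ⊕ Fin m) ℂ) ∈ ltWeight (weight01 m) (1 + 1) :=
  IsWeightedHomogeneous.mem_ltWeight_succ (isWeightedHomogeneous_X ℂ (weight01 m) (Sum.inr i))

theorem pderiv_inl_mem_ltWeight (i : Fin m) {n : ℕ} {q : MvPolynomial (Fin m ⊕ Fin m) ℂ}
    (hq : q ∈ ltWeight (weight01 m) n) :
    pderiv (Sum.inl i) q ∈ ltWeight (weight01 m) n := by
  classical
  rw [as_sum q, map_sum]
  refine Submodule.sum_mem _ fun s hs => ?_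
  rw [pderiv_monomial, mem_ltWeight]
  intro t ht
  rw [coeff_monomial] at ht
  split_ifs at ht with h
  · subst h
    refine lt_of_le_of_lt ?_ (mem_ltWeight.1 hq s (mem_support_iff.1 hs))
    obtain ⟨r, hr⟩ := exists_add_of_le (tsub_le_self : s - Finsupp.single (Sum.inl i) 1 ≤ s)
    conv_rhs => rw [hr, map_add]
    exact Nat.le_add_right _ _
  · exact absurd rfl ht

theorem finsupp_add_single_induction {motive : (Fin m →₀ ℕ) → Prop} (α : Fin m →₀ ℕ)
    (zero : motive 0)
    (add_single : ∀ α i, motive α → motive (α + Finsupp.single i 1)) : motive α := by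
  induction α using Finsupp.induction with
  | zero => exact zero
  | single_add i n α _ _ ih =>
    clear * - ih add_single
    induction n with
    | zero => simpa using ih
    | succ n hn =>
      rw [Finsupp.single_add, add_right_comm]
      exact add_single _ i hn

theorem totalSymbol_xPow_mul (α : Fin m →₀ ℕ) (Q : weyl m) :
    totalSymbol m (xPow α * Q) = monomial (Finsupp.sumElim α 0) 1 * totalSymbol m Q := by
  induction α using finsupp_add_single_induction with
  | zero =>
    have h : xPow (0 : Fin m →₀ ℕ) = (1 : weyl m) := by simp [xPow]
    have h' : Finsupp.sumElim (0 : Fin m →₀ ℕ) (0 : Fin m →₀ ℕ) = 0 := by ext (j | j) <;> simp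
    rw [h, h', one_mul, monomial_zero', C_1, one_mul]
  | add_single α i ih =>
    rw [← x_mul_xPow, mul_assoc, totalSymbol_x_mul, ih, sumElim_add_single_inl, ← mul_assoc,
      mul_comm (X _), monomial_mul_X_eq]

theorem weight_weight01_sumElim (α β : Fin m →₀ ℕ) :
    Finsupp.weight (weight01 m) (Finsupp.sumElim α β) = β.degree := by
  rw [Finsupp.weight_eq_sum, Fintype.sum_sum_type, Finsupp.degree_eq_sum]
  simp [weight01]

theorem monomial_sumElim_mem_ltWeight (α β : Fin m →₀ ℕ) (z : ℂ) :
    monomial (Finsupp.sumElim α β) z ∈ ltWeight (weight01 m) (β.degree + 1) :=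
  IsWeightedHomogeneous.mem_ltWeight_succ
    (isWeightedHomogeneous_monomial _ _ _ (weight_weight01_sumElim α β))

/-- Each further ∂ᵢ multiplies the old error by ξᵢ and adds one x-derivative, which is of lower
weight than the leading product. -/
theorem totalSymbol_dPow_mul_sub_mem (β : Fin m →₀ ℕ) {l : ℕ} {Q : weyl m}
    (hQ : totalSymbol m Q ∈ ltWeight (weight01 m) (l + 1)) :
    totalSymbol m (dPow β * Q) - monomial (Finsupp.sumElim 0 β) 1 * totalSymbol m Q ∈
      ltWeight (weight01 m) (β.degree + l) := by
  induction β using finsupp_add_single_induction with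
  | zero =>
    have h : dPow (0 : Fin m →₀ ℕ) = (1 : weyl m) := by simp [dPow]
    have h' : Finsupp.sumElim (0 : Fin m →₀ ℕ) (0 : Fin m →₀ ℕ) = 0 := by ext (j | j) <;> simp
    rw [h, h', one_mul, monomial_zero', C_1, one_mul, sub_self]
    exact zero_mem _
  | add_single β i ih =>
    set q := totalSymbol m Q
    have e : totalSymbol m (dPow (β + Finsupp.single i 1 : Fin m →₀ ℕ) * Q) -
        monomial (Finsupp.sumElim 0 (β + Finsupp.single i 1)) 1 * q =
        X (Sum.inr i) * (totalSymbol m (dPow β * Q) - monomial (Finsupp.sumElim 0 β) 1 * q) +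
        pderiv (Sum.inl i) (totalSymbol m (dPow β * Q)) := by
      rw [← d_mul_dPow, mul_assoc, totalSymbol_d_mul, sumElim_add_single_inr, ← monomial_mul_X_eq]
      ring
    have hd : (β + Finsupp.single i 1).degree = 1 + β.degree := by
      rw [map_add, Finsupp.degree_single, add_comm]
    rw [e, hd, add_assoc]
    refine Submodule.add_mem _ (mul_mem_ltWeight (X_inr_mem_ltWeight i) ih)
      (pderiv_inl_mem_ltWeight i ?_)
    have := Submodule.add_mem _ (ltWeight_mono _ (Nat.le_succ _) ih)
      (mul_mem_ltWeight (monomial_sumElim_mem_ltWeight (0 : Fin m →₀ ℕ) β 1) hQ)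
    rw [sub_add_cancel] at this
    exact ltWeight_mono _ (by omega) this

/-- Term by term in `P`: x^α multiplies total symbols exactly, and ∂^β does so up to lower order. -/
theorem totalSymbol_mul_sub_mem {k l : ℕ} {P Q : weyl m}
    (hP : totalSymbol m P ∈ ltWeight (weight01 m) (k + 1))
    (hQ : totalSymbol m Q ∈ ltWeight (weight01 m) (l + 1)) :
    totalSymbol m (P * Q) - totalSymbol m P * totalSymbol m Q ∈
      ltWeight (weight01 m) (k + l) := by
  set p := totalSymbol m P with hp
  have hPp : P = ∑ s ∈ p.support, normalOrder m (monomial s (coeff s p)) := by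
    rw [← map_sum, ← as_sum, hp, normalOrder_totalSymbol]
  have e : totalSymbol m (P * Q) - p * totalSymbol m Q = ∑ s ∈ p.support,
      (totalSymbol m (normalOrder m (monomial s (coeff s p)) * Q) -
        monomial s (coeff s p) * totalSymbol m Q) := by
    rw [Finset.sum_sub_distrib, ← Finset.sum_mul, ← as_sum, ← map_sum, ← Finset.sum_mul, ← hPp]
  rw [e]
  refine Submodule.sum_mem _ fun s hs => ?_
  have hs' := mem_ltWeight.1 hP s (mem_support_iff.1 hs)
  obtain ⟨α, β, rfl⟩ := exists_eq_sumElim s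
  rw [weight_weight01_sumElim] at hs'
  generalize coeff (Finsupp.sumElim α β) p = z
  have hm : (monomial (Finsupp.sumElim α β) z : MvPolynomial (Fin m ⊕ Fin m) ℂ) =
      z • (monomial (Finsupp.sumElim α 0) 1 * monomial (Finsupp.sumElim 0 β) 1) := by
    have : Finsupp.sumElim α 0 + Finsupp.sumElim 0 β = Finsupp.sumElim α β := by
      ext (j | j) <;> simp
    rw [monomial_mul, this, smul_monomial]
    simp
  rw [normalOrder_monomial_sumElim, hm, smul_mul_assoc, map_smul, smul_mul_assoc, ← smul_sub,
    mul_assoc, totalSymbol_xPow_mul, mul_assoc, ← mul_sub]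
  refine Submodule.smul_mem _ _ ?_
  have := mul_mem_ltWeight (monomial_sumElim_mem_ltWeight α (0 : Fin m →₀ ℕ) 1)
    (totalSymbol_dPow_mul_sub_mem β hQ)
  exact ltWeight_mono _ (by simp; omega) this

/-- The total symbol as an additive equivalence. -/
def symbolEquiv (m : ℕ) : SymbolEquiv (weyl m) (Fin m ⊕ Fin m) := (totalSymbol m).toAddEquiv

theorem symbolEquiv_apply (P : weyl m) : symbolEquiv m P = totalSymbol m P := rfl

theorem symbolMul_symbolEquiv (m : ℕ) : SymbolMul (weight01 m) (symbolEquiv m) := by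
  intro k l P Q p q hP hQ
  refine ⟨mul_mem_ltWeight_succ hP.1 hQ.1, ?_⟩
  have := Submodule.add_mem _ (totalSymbol_mul_sub_mem hP.mem hQ.mem)
    (mul_sub_mul_mem_ltWeight hP.mem hP.2 hQ.1 hQ.2)
  simp only [symbolEquiv_apply] at this ⊢
  rwa [sub_add_sub_cancel] at this

/-! ### Lauricella's system -/

/-- `xᵢ ξᵢ (∑ⱼ xⱼ ξⱼ - xᵢ² ξᵢ)`, the symbol of `ℓᵢᴮ`. -/
def symbolB (i : Fin m) : MvPolynomial (Fin m ⊕ Fin m) ℂ :=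
  X (Sum.inl i) * X (Sum.inr i) *
    ((∑ j, X (Sum.inl j) * X (Sum.inr j)) - X (Sum.inl i) ^ 2 * X (Sum.inr i))

theorem hasSymbol_x (i : Fin m) :
    HasSymbol (weight01 m) (symbolEquiv m) 0 (x i) (X (Sum.inl i)) := by
  refine ⟨X_inl_mem_ltWeight i, ?_⟩
  rw [symbolEquiv_apply, ← mul_one (x i), totalSymbol_x_mul, totalSymbol_one, mul_one, sub_self]
  exact zero_mem _

theorem hasSymbol_d (i : Fin m) :
    HasSymbol (weight01 m) (symbolEquiv m) 1 (d i) (X (Sum.inr i)) := by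
  refine ⟨X_inr_mem_ltWeight i, ?_⟩
  rw [symbolEquiv_apply, ← mul_one (d i), totalSymbol_d_mul, totalSymbol_one, mul_one, pderiv_one, add_zero,
    sub_self]
  exact zero_mem _

theorem hasSymbol_theta (i : Fin m) :
    HasSymbol (weight01 m) (symbolEquiv m) 1 (theta i) (X (Sum.inl i) * X (Sum.inr i)) :=
  symbolMul_symbolEquiv m 0 1 _ _ _ _ (hasSymbol_x i) (hasSymbol_d i)

theorem totalSymbol_algebraMap_mem (z : ℂ) :
    totalSymbol m (algebraMap ℂ (weyl m) z) ∈ ltWeight (weight01 m) 1 := by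
  rw [totalSymbol_algebraMap]
  exact IsWeightedHomogeneous.mem_ltWeight_succ (isWeightedHomogeneous_C _ z)

/-- The parameters have order 0, below that of θ, and so never reach the symbol. -/
theorem hasSymbol_ellB (a b : Fin m → ℂ) (c : ℂ) (i : Fin m) :
    HasSymbol (weight01 m) (symbolEquiv m) 2 (ellB a b c i) (symbolB i) := by
  have hmul := symbolMul_symbolEquiv m
  have h1 := hmul 1 1 _ _ _ _ (hasSymbol_theta i)
    ((HasSymbol.sum fun j (_ : j ∈ Finset.univ) => hasSymbol_theta j).add_lower
      (totalSymbol_algebraMap_mem (c - 1)))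
  have h2 := hmul 1 1 _ _ _ _ (hmul 0 1 _ _ _ _ (hasSymbol_x i)
    ((hasSymbol_theta i).add_lower (totalSymbol_algebraMap_mem (a i))))
    ((hasSymbol_theta i).add_lower (totalSymbol_algebraMap_mem (b i)))
  have h := h1.sub h2
  have e : symbolB i = X (Sum.inl i) * X (Sum.inr i) *
      (∑ j : Fin m, X (Sum.inl j) * X (Sum.inr j)) -
      X (Sum.inl i) * (X (Sum.inl i) * X (Sum.inr i)) * (X (Sum.inl i) * X (Sum.inr i)) := by
    rw [symbolB]; ring
  rw [e]
  exact h

/-! ### Commutation relations and the lifted Koszul relation -/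

theorem x_mul_x_comm (i j : Fin m) : (x i : weyl m) * x j = x j * x i :=
  Subtype.ext (LinearMap.ext fun f => by
    simp only [Subalgebra.coe_mul, Module.End.mul_apply, x_apply]
    ring)

theorem d_mul_d_comm (i j : Fin m) : (d i : weyl m) * d j = d j * d i := by
  have h : ∀ i j : Fin m, (d i : weyl m) * d j =
      dPow (0 + Finsupp.single j 1 + Finsupp.single i 1 : Fin m →₀ ℕ) := by
    intro i j
    rw [← d_mul_dPow, ← d_mul_dPow]
    simp [dPow]
  rw [h, h, add_right_comm]

theorem d_mul_x (i j : Fin m) :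
    (d i : weyl m) * x j = x j * d i + if i = j then 1 else 0 :=
  Subtype.ext (LinearMap.ext fun f => by
    have h : ((d i * x j : weyl m) : Module.End ℂ (MvPolynomial (Fin m) ℂ)) f =
        pderiv i (X j * f) := rfl
    rw [h, pderiv_mul, pderiv_X]
    by_cases hij : i = j
    · subst hij
      simp [x_apply, d_apply, add_comm]
    · simp [x_apply, d_apply, hij, Ne.symm hij])

theorem theta_mul_x (i j : Fin m) :
    (theta i : weyl m) * x j = x j * theta i + if i = j then x i else 0 := by
  rw [theta, mul_assoc, d_mul_x, mul_add, ← mul_assoc, x_mul_x_comm, mul_assoc]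
  split_ifs <;> simp

theorem theta_mul_theta_comm (i j : Fin m) : (theta i : weyl m) * theta j = theta j * theta i := by
  have h : ∀ i j : Fin m, (theta i : weyl m) * theta j =
      x j * x i * (d i * d j) + if i = j then theta i else 0 := by
    intro i j
    nth_rw 2 [theta]
    rw [← mul_assoc, theta_mul_x, add_mul, theta]
    split_ifs with h <;> simp [mul_assoc, h]
  rw [h, h, x_mul_x_comm, d_mul_d_comm]
  congr 1
  by_cases hij : i = j
  · simp [hij]
  · simp [hij, Ne.symm hij]

/-- To be read with s = θᵢ, t = θⱼ, E = ∑θ + c - 1, y = xᵢ, z = xⱼ, p = (θᵢ + aᵢ)(θᵢ + bᵢ), and q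
likewise for j. Moving E past y creates the extra term t y p, which the correction -t cancels; what
remains is symmetric in the two indices. -/
theorem commutation_relation {R : Type*} [Ring R] {s t E y z p q : R}
    (hst : Commute s t) (hsE : Commute s E) (htE : Commute t E) (htz : Commute t y) (hsy : Commute s z)
    (hyz : Commute y z) (hy : E * y = y * E + y) (hz : E * z = z * E + z) 
    (hpt : Commute p t) (hpE : Commute p E) (hpz : Commute p z) (hqs : Commute q s)
    (hqE : Commute q E) (hqy : Commute q y) (hpq : Commute p q) :
    (t * E - z * q - t) * (s * E - y * p) = (s * E - y * p - s) * (t * E - z * q) := by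
  have h1 : t * E * (s * E) = s * E * (t * E) :=
    ((hst.symm.mul_right htE).mul_left (hsE.symm.mul_right (Commute.refl E))).eq
  have h2 : t * E * (y * p) = y * p * (t * E) + t * (y * p) := by
    rw [mul_assoc, ← mul_assoc E, hy, add_mul, mul_add, mul_assoc y E, ← hpE.eq, ← mul_assoc t y,
      htz.eq, mul_assoc y, ← mul_assoc t p, ← hpt.eq, mul_assoc p, ← mul_assoc]
  have h3 : s * E * (z * q) = z * q * (s * E) + s * (z * q) := by
    rw [mul_assoc, ← mul_assoc E, hz, add_mul, mul_add, mul_assoc z E, ← hqE.eq, ← mul_assoc s z,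
      hsy.eq, mul_assoc z, ← mul_assoc s q, ← hqs.eq, mul_assoc q, ← mul_assoc]
  have h4 : z * q * (y * p) = y * p * (z * q) :=
    ((hyz.symm.mul_right hpz.symm).mul_left (hqy.mul_right hpq.symm)).eq
  have h5 : t * (s * E) = s * (t * E) := by rw [← mul_assoc, ← hst.eq, mul_assoc]
  simp only [mul_sub, sub_mul, h1, h2, h3, h4, h5]
  abel

theorem commutation_relation_of_central {R ι : Type*} [Ring R] [DecidableEq ι] [Fintype ι]
    {θ y A B p q u v : ι → R} {c s E : R} (hy : ∀ i j, Commute (y i) (y j))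
    (hθ : ∀ i j, Commute (θ i) (θ j))
    (hθy : ∀ i j, θ i * y j = y j * θ i + if i = j then y i else 0) (hA : ∀ i P, A i * P = P * A i)
    (hB : ∀ i P, B i * P = P * B i) (hc : ∀ P, c * P = P * c) (hs : s = ∑ j, θ j)
    (hE : E = s + c) (hp : ∀ i, p i = θ i + A i) (hq : ∀ i, q i = θ i + B i)
    (hu : ∀ i, u i = θ i * E) (hv : ∀ i, v i = y i * p i * q i) {L L' : ι → R}
    (hL : ∀ i, L i = u i - v i) (hL' : ∀ i, L' i = L i - θ i) (i j : ι) :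
    L' j * L i = L' i * L j := by
  rcases eq_or_ne i j with rfl | hij
  · rfl
  subst hs hE
  have hθE : ∀ k, Commute (θ k) ((∑ j, θ j) + c) := fun k =>
    (Commute.sum_right _ _ _ fun l _ => hθ k l).add_right (Commute.symm (hc _))
  -- Of the summands of E only θₖ fails to commute with yₖ, and it shifts by one.
  have hEy : ∀ k, ((∑ j, θ j) + c) * y k = y k * ((∑ j, θ j) + c) + y k := fun k => by
    rw [add_mul, Finset.sum_mul, mul_add, Finset.mul_sum, hc]
    simp only [hθy, Finset.sum_add_distrib, Finset.sum_ite_eq', Finset.mem_univ, if_true]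
    abel
  have hθx : ∀ k l, k ≠ l → Commute (θ k) (y l) := fun k l hkl => by
    have := hθy k l
    rwa [if_neg hkl, add_zero] at this
  -- The product pₖqₖ is a polynomial in θₖ with central coefficients.
  have hpq : ∀ (k : ι) (P : R), Commute (θ k) P → Commute (p k * q k) P := fun k P h => by
    rw [hp, hq]
    exact (h.add_left (hA k P)).mul_left (h.add_left (hB k P))
  rw [hL', hL', hL, hL, hu, hu, hv, hv, mul_assoc (y _), mul_assoc (y _)]
  exact commutation_relation (hθ i j) (hθE i) (hθE j) (hθx j i hij.symm) (hθx i j hij)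
    (hy i j) (hEy i) (hEy j)
    (hpq i _ (hθ i j)) (hpq i _ (hθE i)) (hpq i _ (hθx i j hij)) (hpq j _ (hθ j i))
    (hpq j _ (hθE j)) (hpq j _ (hθx j i hij.symm)) (hpq i _ (hpq j _ (hθ j i)).symm)

theorem ellB_relation (a b : Fin m → ℂ) (c : ℂ) (i j : Fin m) :
    (ellB a b c j - theta j) * ellB a b c i = (ellB a b c i - theta i) * ellB a b c j := by
  refine commutation_relation_of_central (R := weyl m) (y := x) (θ := theta)
    (c := algebraMap ℂ (weyl m) (c - 1)) (A := fun i => algebraMap ℂ (weyl m) (a i))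
    (B := fun i => algebraMap ℂ (weyl m) (b i)) (L := ellB a b c)
    (L' := fun i => ellB a b c i - theta i) (s := ∑ j, theta j)
    (E := (∑ j, theta j) + algebraMap ℂ (weyl m) (c - 1))
    (p := fun i => theta i + algebraMap ℂ (weyl m) (a i))
    (q := fun i => theta i + algebraMap ℂ (weyl m) (b i))
    (u := fun i => theta i * ((∑ j, theta j) + algebraMap ℂ (weyl m) (c - 1)))
    (v := fun i => x i * (theta i + algebraMap ℂ (weyl m) (a i)) *
      (theta i + algebraMap ℂ (weyl m) (b i)))
    x_mul_x_comm theta_mul_theta_comm theta_mul_x (fun i P => Algebra.commutes (a i) P)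
    (fun i P => Algebra.commutes (b i) P) (fun P => Algebra.commutes (c - 1) P) ?_ ?_ ?_ ?_
    ?_ ?_ ?_ ?_ i j
  · rfl
  · rfl
  · exact fun _ => rfl
  · exact fun _ => rfl
  · exact fun _ => rfl
  · exact fun _ => rfl
  · exact fun _ => rfl
  · exact fun _ => rfl

/-! ### The symbols and the initial ideal -/

/-- Giving x weight 1 and ξ weight 0 isolates -xᵢ³ξᵢ² in weight 3, the rest of the symbol having
weight 2. -/
theorem koszulExact_symbolB (m : ℕ) : KoszulExact (symbolB (m := m)) := by
  classical
  set w : Fin m ⊕ Fin m → ℕ := Sum.elim (fun _ => 1) (fun _ => 0) with hw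
  set t : Fin m → (Fin m ⊕ Fin m →₀ ℕ) := fun i =>
    Finsupp.single (Sum.inl i) 3 + Finsupp.single (Sum.inr i) 2 with ht
  refine (koszulExact_monomial t (fun _ => -1) (fun _ => by simp) fun i j hij => ?_).of_symbol
    (w := w) (e := 3) (fun i => isWeightedHomogeneous_monomial _ _ _ ?_) fun i => ?_
  · rw [Finset.disjoint_left]
    rintro (k | k) hi hj <;> simp [ht, Finsupp.single_apply] at hi hj <;>
      exact hij (hi.trans hj.symm)
  · simp [ht, hw, Finsupp.weight_single]
  · have hX : ∀ j : Fin m, IsWeightedHomogeneous w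
        (X (Sum.inl j) * X (Sum.inr j) : MvPolynomial (Fin m ⊕ Fin m) ℂ) (1 + 0) := fun j =>
      (isWeightedHomogeneous_X ℂ w (Sum.inl j)).mul (isWeightedHomogeneous_X ℂ w (Sum.inr j))
    have e : symbolB i - monomial (t i) (-1) =
        X (Sum.inl i) * X (Sum.inr i) * ∑ j, X (Sum.inl j) * X (Sum.inr j) := by
      have : monomial (t i) (-1 : ℂ) = -(X (Sum.inl i) ^ 3 * X (Sum.inr i) ^ 2) := by
        rw [X_pow_eq_monomial, X_pow_eq_monomial, monomial_mul, one_mul, map_neg]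
      rw [this, symbolB]
      ring
    rw [e]
    exact IsWeightedHomogeneous.mem_ltWeight_succ
      ((hX i).mul (IsWeightedHomogeneous.sum _ _ _ fun j _ => hX j))

theorem symbolB_isWeightedHomogeneous (i : Fin m) :
    IsWeightedHomogeneous (weight01 m) (symbolB i) 2 := by
  have hl : ∀ j : Fin m, IsWeightedHomogeneous (weight01 m)
      (X (Sum.inl j) : MvPolynomial (Fin m ⊕ Fin m) ℂ) 0 := fun j =>
    isWeightedHomogeneous_X ℂ _ _
  have hr : ∀ j : Fin m, IsWeightedHomogeneous (weight01 m)
      (X (Sum.inr j) : MvPolynomial (Fin m ⊕ Fin m) ℂ) 1 := fun j =>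
    isWeightedHomogeneous_X ℂ _ _
  have h1 : ∀ j : Fin m, IsWeightedHomogeneous (weight01 m)
      (X (Sum.inl j) * X (Sum.inr j) : MvPolynomial (Fin m ⊕ Fin m) ℂ) 1 := fun j => by
    simpa using (hl j).mul (hr j)
  have h2 : IsWeightedHomogeneous (weight01 m)
      (X (Sum.inl i) ^ 2 * X (Sum.inr i) : MvPolynomial (Fin m ⊕ Fin m) ℂ) 1 := by
    simpa using ((hl i).pow 2).mul (hr i)
  exact (h1 i).mul ((IsWeightedHomogeneous.sum _ _ _ fun j _ => h1 j).sub h2)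

theorem symbolB_ne_zero (i : Fin m) : symbolB i ≠ 0 := by
  classical
  intro h
  -- At x = (2, …, 2) and ξ the i-th unit vector the value is 2(2 - 4); with x = (1, …, 1) it would
  -- vanish.
  have := congrArg (eval (Sum.elim (fun _ => 2) (Pi.single i 1))) h
  simp [symbolB, Pi.single_apply] at this
  norm_num at this

theorem initialForm_eq {P : weyl m} {k : ℕ} {p : MvPolynomial (Fin m ⊕ Fin m) ℂ}
    (hP : HasSymbol (weight01 m) (symbolEquiv m) k P p)
    (hp : IsWeightedHomogeneous (weight01 m) p k) (hp0 : p ≠ 0) : initialForm P = p := by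
  have hk : weightedTotalDegree (weight01 m) (totalSymbol m P) = k := by
    apply le_antisymm
    · exact Finset.sup_le fun s hs =>
        Nat.le_of_lt_succ (mem_ltWeight.1 hP.mem s (mem_support_iff.1 hs))
    · by_contra! hlt
      refine hp0 (IsWeightedHomogeneous.eq_zero_of_mem_ltWeight hp ?_)
      have := Submodule.sub_mem _
        (ltWeight_mono _ hlt (mem_ltWeight_weightedTotalDegree _ (totalSymbol m P))) hP.2
      rwa [symbolEquiv_apply, sub_sub_cancel] at this
  rw [initialForm, hk, ← symbolEquiv_apply, component_eq_of_sub_mem hp hP.2]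

/-- Once the coefficients have order at most n - 2, the part of order n of `P` is the combination of
the symbols with the parts of order n - 2 as coefficients. -/
theorem initialForm_mem_of_mem_idealB (a b : Fin m → ℂ) (c : ℂ) {P : weyl m}
    (hP : P ∈ idealB a b c) : initialForm P ∈ Ideal.span (Set.range (symbolB (m := m))) := by
  obtain ⟨B, hB⟩ := (Submodule.mem_span_range_iff_exists_fun (weyl m)).1 hP
  simp only [smul_eq_mul] at hB
  set n := weightedTotalDegree (weight01 m) (totalSymbol m P) with hn
  have hL := hasSymbol_ellB a b c
  have hL' : ∀ i, HasSymbol (weight01 m) (symbolEquiv m) 2 (ellB a b c i - theta i)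
      (symbolB i) := fun i => by
    simpa using (hL i).sub (hasSymbol_zero_iff.2 (hasSymbol_theta i).mem)
  obtain ⟨B', hPB, hHB⟩ := (koszulExact_symbolB m).exists_coeff_mem_ltWeight
    (symbolMul_symbolEquiv m) symbolB_isWeightedHomogeneous hL hL' (ellB_relation a b c) B
    (n := n + 1) (by rw [hB]; exact mem_ltWeight_weightedTotalDegree _ _)
  rw [hB] at hPB
  -- For n < 2 the bound n + 1 - 2 is 0, so all coefficients vanish and P = 0.
  by_cases h2 : n + 1 ≤ 2
  · have hB0 : ∀ i, B' i = 0 := fun i => by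
      have := hHB i
      rw [Nat.sub_eq_zero_of_le h2] at this
      exact (symbolEquiv m).map_eq_zero_iff.1 (eq_zero_of_mem_ltWeight_zero this)
    have hP0 : P = 0 := by rw [hPB]; simp [hB0]
    rw [hP0, initialForm, map_zero, map_zero]
    exact zero_mem _
  · obtain ⟨k, hk⟩ : ∃ k, n = k + 2 := ⟨n - 2, by omega⟩
    have hBk : ∀ i, HasSymbol (weight01 m) (symbolEquiv m) k (B' i)
        (weightedHomogeneousComponent (weight01 m) k (symbolEquiv m (B' i))) := fun i =>
      hasSymbol_component (by rw [hk] at hHB; exact hHB i)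
    have hs := HasSymbol.sum fun i (_ : i ∈ Finset.univ) =>
      symbolMul_symbolEquiv m k 2 _ _ _ _ (hBk i) (hL i)
    rw [← hPB] at hs
    rw [initialForm, ← hn, hk, ← symbolEquiv_apply, component_eq_of_sub_mem
      (IsWeightedHomogeneous.sum _ _ _ fun i _ => (weightedHomogeneousComponent_isWeightedHomogeneous ..).mul
        (symbolB_isWeightedHomogeneous i)) hs.2]
    exact Submodule.sum_mem _ fun i _ => Ideal.mul_mem_left _ _ (Ideal.subset_span ⟨i, rfl⟩)

/-- The symbols of the `ℓᵢᴮ` generate the initial form ideal. -/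
theorem initialIdeal_idealB (a b : Fin m → ℂ) (c : ℂ) :
    initialIdeal (idealB a b c) = Ideal.span (Set.range (symbolB (m := m))) := by
  apply le_antisymm
  · rw [initialIdeal, Ideal.span_le]
    rintro _ ⟨P, hP, rfl⟩
    exact initialForm_mem_of_mem_idealB a b c hP
  · rw [Ideal.span_le]
    rintro _ ⟨i, rfl⟩
    exact Ideal.subset_span ⟨ellB a b c i, Ideal.subset_span ⟨i, rfl⟩,
      (initialForm_eq (hasSymbol_ellB a b c i) (symbolB_isWeightedHomogeneous i)
        (symbolB_ne_zero i)).symm⟩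

/-! ### Characteristic variety and singular locus -/

theorem mem_charVariety_idealB (a b : Fin m → ℂ) (c : ℂ) (p : Fin m ⊕ Fin m → ℂ) :
    p ∈ charVariety (idealB a b c) ↔ ∀ i, p (Sum.inl i) * p (Sum.inr i) *
      ((∑ j, p (Sum.inl j) * p (Sum.inr j)) - p (Sum.inl i) ^ 2 * p (Sum.inr i)) = 0 := by
  have h : ∀ i, aeval p (symbolB i) = p (Sum.inl i) * p (Sum.inr i) *
      ((∑ j, p (Sum.inl j) * p (Sum.inr j)) - p (Sum.inl i) ^ 2 * p (Sum.inr i)) := by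
    simp [symbolB]
  rw [charVariety, initialIdeal_idealB, mem_zeroLocus_iff]
  simp only [← h]
  refine ⟨fun hp i => hp _ (Ideal.subset_span ⟨i, rfl⟩), fun hp => ?_⟩
  have : Ideal.span (Set.range (symbolB (m := m))) ≤ RingHom.ker (aeval (R := ℂ) p) := by
    rw [Ideal.span_le]
    rintro _ ⟨i, rfl⟩
    exact hp i
  exact fun q hq => this hq

theorem mem_singularLocus_idealB (a b : Fin m → ℂ) (c : ℂ) (y : Fin m → ℂ) :
    y ∈ singularLocus (idealB a b c) ↔ ∃ ξ : Fin m → ℂ, ξ ≠ 0 ∧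
      ∀ i, y i * ξ i * ((∑ j, y j * ξ j) - y i ^ 2 * ξ i) = 0 := by
  constructor
  · rintro ⟨p, ⟨hp, hξ⟩, rfl⟩
    exact ⟨fun i => p (Sum.inr i), fun h => hξ (congrFun h), (mem_charVariety_idealB a b c p).1 hp⟩
  · rintro ⟨ξ, hξ, h⟩
    exact ⟨Sum.elim y ξ, ⟨(mem_charVariety_idealB a b c _).2 h, fun h0 => hξ (funext h0)⟩, rfl⟩

theorem prod_sub_sum_prod_erase {y : Fin m → ℂ} (hy : ∀ i, y i ≠ 0) (S : Finset (Fin m)) :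
    (∏ i ∈ S, y i) - ∑ k ∈ S, ∏ l ∈ S.erase k, y l =
      (∏ i ∈ S, y i) * (1 - ∑ k ∈ S, (y k)⁻¹) := by
  rw [mul_sub, mul_one, Finset.mul_sum]
  congr 1
  refine Finset.sum_congr rfl fun k hk => ?_
  rw [← Finset.mul_prod_erase S y hk, mul_right_comm, mul_inv_cancel₀ (hy k), one_mul]

/-- The factors 1 - xᵢ are the case of singletons S; the empty S never occurs, its sum being 0. -/
theorem eval_singPolyB_eq_zero_iff {y : Fin m → ℂ} (hy : ∀ i, y i ≠ 0) :
    eval y (singPolyB m) = 0 ↔ ∃ S : Finset (Fin m), ∑ k ∈ S, (y k)⁻¹ = 1 := by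
  simp only [singPolyB, map_mul, map_prod, map_sub, map_sum, map_one, eval_X, mul_eq_zero,
    Finset.prod_eq_zero_iff, Finset.mem_univ, true_and, Finset.mem_filter, hy, exists_false,
    false_or, prod_sub_sum_prod_erase hy, and_false, sub_eq_zero]
  constructor
  · rintro (⟨i, hi⟩ | ⟨S, -, hS⟩)
    · exact ⟨{i}, by simp [← hi]⟩
    · exact ⟨S, hS.symm⟩
  · rintro ⟨S, hS⟩
    rcases lt_or_ge S.card 2 with h | h
    · left
      have h1 : S.card = 1 := by
        have : S.card ≠ 0 := fun h0 => by simp [Finset.card_eq_zero.1 h0] at hS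
        omega
      obtain ⟨i, rfl⟩ := Finset.card_eq_one.1 h1
      exact ⟨i, by simpa [eq_comm] using hS⟩
    · exact Or.inr ⟨S, h, hS.symm⟩

theorem exists_covector_iff (y : Fin m → ℂ) :
    (∃ ξ : Fin m → ℂ, ξ ≠ 0 ∧ ∀ i, y i * ξ i * ((∑ j, y j * ξ j) - y i ^ 2 * ξ i) = 0) ↔
      eval y (singPolyB m) = 0 := by
  classical
  by_cases hy : ∃ i, y i = 0
  · obtain ⟨i, hi⟩ := hy
    -- Each equation has the factor yⱼξⱼ, which is zero for this ξ.
    refine iff_of_true ⟨Pi.single i 1, by simp, fun j => ?_⟩ ?_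
    · rcases eq_or_ne j i with rfl | hj
      · simp [hi]
      · simp [hj]
    · simp [singPolyB, Finset.prod_eq_zero (Finset.mem_univ i) hi]
  push Not at hy
  rw [eval_singPolyB_eq_zero_iff hy]
  constructor
  · rintro ⟨ξ, hξ, h⟩
    set s := ∑ j, y j * ξ j with hs
    have hi : ∀ i, ξ i ≠ 0 → y i * ξ i = s * (y i)⁻¹ := fun i hi => by
      have := (mul_eq_zero.1 (h i)).resolve_left (mul_ne_zero (hy i) hi)
      rw [sub_eq_zero.1 this, pow_two]
      field_simp [hy i]
    have hs0 : s ≠ 0 := fun h0 => hξ (funext fun i => by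
      by_contra hne
      have := hi i hne
      rw [h0, zero_mul] at this
      exact mul_ne_zero (hy i) hne this)
    -- S is the support of ξ, and s · ∑_{i∈S} 1/yᵢ = ∑ yᵢξᵢ = s.
    refine ⟨Finset.univ.filter fun i => ξ i ≠ 0, mul_left_cancel₀ hs0 ?_⟩
    rw [Finset.mul_sum, mul_one]
    conv_rhs => rw [hs]
    rw [Finset.sum_filter]
    refine Finset.sum_congr rfl fun i _ => ?_
    split_ifs with hne
    · exact (hi i hne).symm
    · rw [not_not.1 hne, mul_zero]
  · rintro ⟨S, hS⟩
    -- The covector 1/yⱼ² on S is scaled so that s = 1, which also shows that it is nonzero.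
    have hsum : ∑ j, y j * (if j ∈ S then (y j ^ 2)⁻¹ else 0) = 1 := by
      simp only [mul_ite, mul_zero]
      rw [Finset.sum_ite_mem, Finset.univ_inter, ← hS]
      refine Finset.sum_congr rfl fun j _ => ?_
      have := hy j
      field_simp
    refine ⟨fun i => if i ∈ S then (y i ^ 2)⁻¹ else 0, fun h0 => ?_, fun i => ?_⟩
    · have h0' : ∀ i, (if i ∈ S then (y i ^ 2)⁻¹ else 0) = 0 := congrFun h0
      simp [h0'] at hsum
    · rw [hsum]
      dsimp only
      split_ifs
      · rw [mul_inv_cancel₀ (pow_ne_zero 2 (hy i)), sub_self, mul_zero]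
      · simp

end Lauricella

end

theorem mainTheorem2 (m : ℕ) (a b : Fin m → ℂ) (c : ℂ) :
    Lauricella.singularLocus (Lauricella.idealB a b c) =
      {x : Fin m → ℂ | MvPolynomial.eval x (Lauricella.singPolyB m) = 0} := by
  ext y
  exact (Lauricella.mem_singularLocus_idealB a b c y).trans (Lauricella.exists_covector_iff y)
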